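/- For integers $n\ge 0$ put $P_0(a,b,c)=1$ and, for $n\ge1$, $P_n(a,b,c)=c\prod_{i=1}^{n-1}\bigl(ia+(n-i)b+c\bigr)$. Let $k\ge 0$ be an integer. A $k$-colored ordered tree is an ordered (plane) rooted tree whose edges are colored with the colors $1,\dots,k$ in such a way that, among the children of any vertex, those joined to it by an edge of color $1$ come first, then those of color $2$, and so on (not every color need appear; for $k=0$ the only such tree is a single vertex). A $k$-colored ordered forest is a finite, possibly empty, sequence of $k$-colored ordered trees. For a vertex $v$ of a tree or forest, the hook length $h(v)$ is the number of descendants of $v$, including $v$ itself. Let $\alpha$ be an element of a field of characteristic $0$ (for instance an indeterminate over $\mathbb{Q}$). Then for every $n\ge 0$ $$n!\sum_F \prod_{v\in V(F)}\left(1+\frac{\alpha}{h(v)}\right)=P_n\bigl(k,(k+1)(1+\alpha),1+\alpha\bigr),$$ where the sum is over all unlabeled $k$-colored ordered forests $F$ on $n$ vertices, and for every $n\ge 1$ $$n!\sum_T \prod_{v\in V(T)}\left(1+\frac{\alpha}{h(v)}\right)=-P_n\bigl(k,(k+1)(1+\alpha),-(1+\alpha)\bigr),$$ where the sum is over all unlabeled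 $k$-colored ordered trees $T$ on $n$ vertices. -/

import Mathlib

/-- The polynomial `P_n(a,b,c)`, equal to `c ∏_{i=1}^{n-1} (i a + (n-i) b + c)` for `n ≥ 1`,
with the convention `P_0 = 1`. -/
def gesselSeoP {R : Type*} [CommRing R] (n : ℕ) (a b c : R) : R :=
  if n = 0 then 1
  else c * ∏ i ∈ Finset.Icc 1 (n - 1), ((i : R) * a + ((n : R) - (i : R)) * b + c)

/-- Finite unlabeled ordered (plane) rooted trees in which every edge carries a color from a
set of `k` colors: a tree is given by the sequence of its root's children, in order, each child
being recorded as the color of the edge to it together with the subtree rooted at it. -/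
inductive EdgeColoredTree (k : ℕ) : Type
  | node (children : List (Fin k × EdgeColoredTree k)) : EdgeColoredTree k

namespace EdgeColoredTree

variable {k : ℕ}

/-- The root's children, each with the color of the edge to it. -/
def children : EdgeColoredTree k → List (Fin k × EdgeColoredTree k)
  | node cs => cs

mutual
/-- The vertices of a tree in preorder, with one entry for every vertex; a vertex is represented
by the subtree rooted at it, i.e. the subtree formed by its descendants (itself included). -/
def vertices : EdgeColoredTree k → List (EdgeColoredTree k)
  | node cs => node cs :: verticesOfChildren cs
/-- The concatenation of the vertex lists of the subtrees in a list of (color, subtree) pairs. -/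
def verticesOfChildren : List (Fin k × EdgeColoredTree k) → List (EdgeColoredTree k)
  | [] => []
  | (_, t) :: cs => vertices t ++ verticesOfChildren cs
end

/-- The number of vertices of a tree. For the subtree rooted at a vertex `v` this is the number
of descendants of `v`, including `v`, i.e. the hook length of `v`. -/
def size (t : EdgeColoredTree k) : ℕ := t.vertices.length

/-- `k`-colored ordered trees: among the children of any vertex, those of the first color come
first, then those of the second color, and so on. -/
def IsKColored (t : EdgeColoredTree k) : Prop :=
  ∀ v ∈ t.vertices, (v.children.map Prod.fst).Pairwise (· ≤ ·)

/-- The product of `1 + α / h(v)` over the vertices `v` of a tree. -/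
def hookProd {R : Type*} [Field R] (α : R) (t : EdgeColoredTree k) : R :=
  (t.vertices.map fun v => 1 + α / (v.size : R)).prod

theorem size_node (cs : List (Fin k × EdgeColoredTree k)) :
    (node cs).size = 1 + (cs.map fun p => p.2.size).sum := by
  have h : ∀ l : List (Fin k × EdgeColoredTree k),
      (verticesOfChildren l).length = (l.map fun p => p.2.size).sum := by
    intro l
    induction l with
    | nil => simp [verticesOfChildren]
    | cons p l ih => obtain ⟨c, t⟩ := p; simp [verticesOfChildren, ih, size]
  rw [← h, size, vertices, List.length_cons, add_comm]

theorem size_pos (t : EdgeColoredTree k) : 0 < t.size := by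
  obtain ⟨cs⟩ := t
  rw [size_node]; omega

theorem finite_lists {A : Type*} (S : Set A) (hS : S.Finite) (n : ℕ) :
    {l : List A | (∀ a ∈ l, a ∈ S) ∧ l.length ≤ n}.Finite := by
  have : Finite S := hS
  refine ((List.finite_length_le S n).image (List.map Subtype.val)).subset ?_
  rintro l ⟨hl, hn⟩
  refine ⟨l.attach.map fun x => ⟨x.1, hl x.1 x.2⟩, by simpa using hn, ?_⟩
  simp [List.map_map, Function.comp_def]

theorem length_le_sum {A : Type*} (f : A → ℕ) (l : List A) (hf : ∀ a, 0 < f a) :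
    l.length ≤ (l.map f).sum := by
  induction l with
  | nil => simp
  | cons a l ih => have := hf a; simp only [List.length_cons, List.map_cons, List.sum_cons]; omega

theorem finite_size_le (k n : ℕ) : {t : EdgeColoredTree k | t.size ≤ n}.Finite := by
  induction n with
  | zero =>
    convert Set.finite_empty
    ext t
    have := t.size_pos
    simp; omega
  | succ n ih =>
    refine ((finite_lists (Set.univ ×ˢ {t : EdgeColoredTree k | t.size ≤ n})
      (Set.finite_univ.prod ih) n).image node).subset ?_
    rintro ⟨cs⟩ h
    simp only [Set.mem_ofPred_eq, size_node] at h
    refine ⟨cs, ⟨fun p hp => ⟨Set.mem_univ _, ?_⟩, ?_⟩, rfl⟩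
    · have : p.2.size ≤ (cs.map fun p => p.2.size).sum :=
        List.le_sum_of_mem (List.mem_map.2 ⟨p, hp, rfl⟩)
      simp only [Set.mem_ofPred_eq]; omega
    · have := length_le_sum (fun p : Fin k × EdgeColoredTree k => p.2.size) cs
        (fun p => p.2.size_pos)
      omega

end EdgeColoredTree

/-- An ordered forest with colored edges: a finite sequence of ordered trees with colored edges.
The roots carry no color. -/
abbrev EdgeColoredForest (k : ℕ) : Type := List (EdgeColoredTree k)

namespace EdgeColoredForest

variable {k : ℕ}

/-- The number of vertices of a forest. -/
def size (F : EdgeColoredForest k) : ℕ := (F.map EdgeColoredTree.size).sum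

/-- `k`-colored ordered forests: sequences of `k`-colored ordered trees. -/
def IsKColored (F : EdgeColoredForest k) : Prop := ∀ t ∈ F, t.IsKColored

/-- The product of `1 + α / h(v)` over the vertices `v` of a forest. -/
def hookProd {R : Type*} [Field R] (α : R) (F : EdgeColoredForest k) : R :=
  (F.map (EdgeColoredTree.hookProd α)).prod

end EdgeColoredForest

theorem finite_kColoredOrderedTrees (k n : ℕ) :
    {t : EdgeColoredTree k | t.IsKColored ∧ t.size = n}.Finite :=
  (EdgeColoredTree.finite_size_le k n).subset fun _ h => h.2.le

theorem finite_kColoredOrderedForests (k n : ℕ) :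
    {F : EdgeColoredForest k | F.IsKColored ∧ F.size = n}.Finite := by
  refine (EdgeColoredTree.finite_lists _ (EdgeColoredTree.finite_size_le k n) n).subset ?_
  rintro F ⟨-, h⟩
  rw [EdgeColoredForest.size] at h
  refine ⟨fun t ht => ?_, ?_⟩
  · exact (List.le_sum_of_mem (List.mem_map.2 ⟨t, ht, rfl⟩)).trans h.le
  · exact (EdgeColoredTree.length_le_sum _ F EdgeColoredTree.size_pos).trans h.le

/-- The finite set of unlabeled `k`-colored ordered trees on `n` vertices. -/
noncomputable def kColoredOrderedTrees (k n : ℕ) : Finset (EdgeColoredTree k) :=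
  (finite_kColoredOrderedTrees k n).toFinset

/-- The finite set of unlabeled `k`-colored ordered forests on `n` vertices. -/
noncomputable def kColoredOrderedForests (k n : ℕ) : Finset (EdgeColoredForest k) :=
  (finite_kColoredOrderedForests k n).toFinset

-- Put `s = 1 + α` and let `G_c` be the exponential generating function of `P_n(a,b,c)`. The
-- analytic core is `G_c * G_d = G_(c+d)` (`gesselSeoSeries_mul`), an Abel–Rothe type convolution.
-- Weighted by hook products, the forest series `F` and tree series `T` satisfy `F = 1/(1 - T)`, and
-- lists of children are counted by `F^k`, one factor per color. Removing the root gives `[x^(n+1)]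
-- T = (1 + α/(n+1)) [x^n] F^k`, a recursion with a unique solution. With `a = k`, `b = (k+1)s`, the
-- choice `T = 1 - G_(-s)` makes `F^k = G_(ks)`, and the recursion becomes
-- `neg_gesselSeoP_succ_neg`.

open PowerSeries

-- The series of `P_n` and its multiplicativity in `c`.

theorem gesselSeoP_zero {R : Type*} [CommRing R] (a b c : R) : gesselSeoP 0 a b c = 1 := by
  simp [gesselSeoP]

theorem gesselSeoP_succ {R : Type*} [CommRing R] (n : ℕ) (a b c : R) :
    gesselSeoP (n + 1) a b c
      = c * ∏ i ∈ Finset.range n, (((i : R) + 1) * a + ((n : R) - (i : R)) * b + c) := by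
  rw [gesselSeoP, if_neg n.succ_ne_zero, Nat.add_sub_cancel, Finset.range_eq_Ico,
    ← Finset.Ico_add_one_right_eq_Icc, ← zero_add 1, ← Finset.prod_Ico_add']
  simp

theorem map_gesselSeoP {R S : Type*} [CommRing R] [CommRing S] (f : R →+* S) (n : ℕ) (a b c : R) :
    f (gesselSeoP n a b c) = gesselSeoP n (f a) (f b) (f c) := by
  cases n <;> simp [gesselSeoP_zero, gesselSeoP_succ]

/-- For `n ≥ 1` the two products share the factors of `P_n(a,b,c)`; what remains is `(c-b)(na+c) -
(c-a)(nb+c) = (n+1)(a-b)c`. -/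
theorem gesselSeoP_sub_sub_gesselSeoP_sub {R : Type*} [CommRing R] (n : ℕ) (a b c : R) :
    gesselSeoP (n + 1) a b (c - b) - gesselSeoP (n + 1) a b (c - a)
      = ((n : R) + 1) * (a - b) * gesselSeoP n a b c := by
  cases n with
  | zero => simp [gesselSeoP_succ, gesselSeoP_zero]
  | succ n =>
    rw [gesselSeoP_succ, gesselSeoP_succ, gesselSeoP_succ, Finset.prod_range_succ,
      Finset.prod_range_succ']
    have h1 : ∀ i ∈ Finset.range n, (((i : R) + 1) * a + (((n + 1 : ℕ) : R) - (i : R)) * b + (c - b))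
        = ((i : R) + 1) * a + ((n : R) - (i : R)) * b + c := fun i _ => by push_cast; ring
    have h2 : ∀ i ∈ Finset.range n,
        ((((i + 1 : ℕ) : R) + 1) * a + (((n + 1 : ℕ) : R) - ((i + 1 : ℕ) : R)) * b + (c - a))
        = ((i : R) + 1) * a + ((n : R) - (i : R)) * b + c := fun i _ => by push_cast; ring
    rw [Finset.prod_congr rfl h1, Finset.prod_congr rfl h2]
    push_cast
    ring

/-- The exponential generating function of the sequence `P_n(a,b,c)`. -/
noncomputable def gesselSeoSeries {R : Type*} [Field R] (a b c : R) : R⟦X⟧ :=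
  PowerSeries.mk fun n => gesselSeoP n a b c / n.factorial

theorem gesselSeoSeries_zero {R : Type*} [Field R] (a b : R) : gesselSeoSeries a b 0 = 1 := by
  ext n
  cases n <;> simp [gesselSeoSeries, gesselSeoP_zero, gesselSeoP_succ, coeff_one]

theorem gesselSeoSeries_sub_sub {R : Type*} [Field R] [CharZero R] (a b c : R) :
    gesselSeoSeries a b (c - b) - gesselSeoSeries a b (c - a)
      = X * (C (a - b) * gesselSeoSeries a b c) := by
  ext n
  cases n with
  | zero => simp [gesselSeoSeries, gesselSeoP_zero]
  | succ n =>
    rw [coeff_succ_X_mul, coeff_C_mul, map_sub]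
    simp only [gesselSeoSeries, coeff_mk]
    rw [← sub_div, gesselSeoP_sub_sub_gesselSeoP_sub, Nat.factorial_succ]
    have h1 : (n.factorial : R) ≠ 0 := mod_cast n.factorial_ne_zero
    have h2 : (n : R) + 1 ≠ 0 := mod_cast n.succ_ne_zero
    push_cast
    field_simp

/-- A polynomial taking equal values at `x` and `x + p` for all `x`, `p ≠ 0`, is constant. -/
theorem Polynomial.eval_eq_of_periodic {R : Type*} [Field R] [CharZero R] (f : Polynomial R)
    {p : R} (hp : p ≠ 0) (h : ∀ x, f.eval (x + p) = f.eval x) (x : R) : f.eval x = f.eval 0 := by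
  have hn : ∀ n : ℕ, f.eval (n * p) = f.eval 0 := by
    intro n
    induction n with
    | zero => simp
    | succ n ih => rw [← ih, ← h (n * p)]; push_cast; ring_nf
  have : f = Polynomial.C (f.eval 0) := by
    refine Polynomial.eq_of_infinite_eval_eq _ _ (Set.Infinite.mono (s := Set.range fun n : ℕ => (n : R) * p) ?_ ?_)
    · rintro _ ⟨n, rfl⟩
      simpa using hn n
    · refine Set.infinite_range_of_injective fun m n hmn => ?_
      simpa [hp] using hmn
  rw [this]; simp

theorem coeff_gesselSeoSeries_mul {R : Type*} [Field R] (n : ℕ) (a b c d : R) :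
    coeff n (gesselSeoSeries a b c * gesselSeoSeries a b d)
      = ∑ p ∈ Finset.HasAntidiagonal.antidiagonal n, (gesselSeoP p.1 a b c / p.1.factorial)
          * (gesselSeoP p.2 a b d / p.2.factorial) := by
  simp [coeff_mul, gesselSeoSeries]

/-- Taking polynomial parameters allows varying `c` for the periodicity argument and `a` for the
extension to `a = b`. -/
theorem exists_polynomial_eval_defect {R : Type*} [Field R] (n : ℕ) (a b c d : Polynomial R) :
    ∃ f : Polynomial R, ∀ x, f.eval x =
      coeff n (gesselSeoSeries (a.eval x) (b.eval x) (c.eval x)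
          * gesselSeoSeries (a.eval x) (b.eval x) (d.eval x)
        - gesselSeoSeries (a.eval x) (b.eval x) (c.eval x + d.eval x)) := by
  refine ⟨∑ p ∈ Finset.HasAntidiagonal.antidiagonal n,
      (gesselSeoP p.1 a b c * Polynomial.C (p.1.factorial : R)⁻¹)
        * (gesselSeoP p.2 a b d * Polynomial.C (p.2.factorial : R)⁻¹)
      - gesselSeoP n a b (c + d) * Polynomial.C (n.factorial : R)⁻¹, fun x => ?_⟩
  have h := fun m (u v w : Polynomial R) => map_gesselSeoP (Polynomial.evalRingHom x) m u v w
  simp only [Polynomial.coe_evalRingHom] at h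
  rw [map_sub, coeff_gesselSeoSeries_mul, Polynomial.eval_sub, Polynomial.eval_finsetSum]
  simp [h, gesselSeoSeries, div_eq_mul_inv]

theorem gesselSeoSeries_mul_of_ne {R : Type*} [Field R] [CharZero R] {a b : R} (hab : a ≠ b)
    (c d : R) :
    gesselSeoSeries a b c * gesselSeoSeries a b d = gesselSeoSeries a b (c + d) := by
  ext n
  induction n generalizing c with
  | zero => simp [coeff_mul, gesselSeoSeries, gesselSeoP_zero]
  | succ n ih =>
    obtain ⟨f, hf⟩ := exists_polynomial_eval_defect (n + 1) (.C a) (.C b) .X (.C d)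
    simp only [Polynomial.eval_C, Polynomial.eval_X] at hf
    have h0 : f.eval 0 = 0 := by rw [hf]; simp [gesselSeoSeries_zero]
    have hper : ∀ x, f.eval (x + (a - b)) = f.eval x := by
      intro x
      -- The defect `D(x) = G_x G_d - G_(x+d)` inherits the difference equation `D(x+a-b) - D(x) =
      -- (a-b) X D(x+a)`. The factor `X` lowers the degree, so induction, with `c` free, kills the
      -- right side.
      have e : ∀ y, gesselSeoSeries a b (x + (a - b) + y) - gesselSeoSeries a b (x + y)
          = X * (C (a - b) * gesselSeoSeries a b (x + a + y)) := by
        intro y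
        rw [← gesselSeoSeries_sub_sub]
        ring_nf
      rw [← sub_eq_zero, hf, hf, ← map_sub]
      have e0 := e 0
      simp only [add_zero] at e0
      have : gesselSeoSeries a b (x + (a - b)) * gesselSeoSeries a b d
            - gesselSeoSeries a b (x + (a - b) + d)
            - (gesselSeoSeries a b x * gesselSeoSeries a b d - gesselSeoSeries a b (x + d))
          = X * (C (a - b) * (gesselSeoSeries a b (x + a) * gesselSeoSeries a b d
              - gesselSeoSeries a b (x + a + d))) := by
        linear_combination gesselSeoSeries a b d * e0 - e d
      rw [this, coeff_succ_X_mul, coeff_C_mul, map_sub, ih, sub_self, mul_zero]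
    have := f.eval_eq_of_periodic (sub_ne_zero.2 hab) hper c
    rw [h0, hf, map_sub] at this
    exact sub_eq_zero.1 this

/-- At `a = b` the period vanishes, but each coefficient of the defect is a polynomial in `a` with
infinitely many roots. -/
theorem gesselSeoSeries_mul {R : Type*} [Field R] [CharZero R] (a b c d : R) :
    gesselSeoSeries a b c * gesselSeoSeries a b d = gesselSeoSeries a b (c + d) := by
  ext n
  obtain ⟨f, hf⟩ := exists_polynomial_eval_defect n .X (.C b) (.C c) (.C d)
  simp only [Polynomial.eval_C, Polynomial.eval_X] at hf
  have : f = 0 := by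
    refine Polynomial.eq_zero_of_infinite_isRoot _
      (Set.Infinite.mono (s := {b}ᶜ) ?_ (Set.finite_singleton b).infinite_compl)
    intro x hx
    change f.eval x = 0
    rw [hf, gesselSeoSeries_mul_of_ne hx, sub_self, map_zero]
  have h := hf a
  rw [this, Polynomial.eval_zero, map_sub] at h
  exact (sub_eq_zero.1 h.symm)

theorem gesselSeoSeries_pow {R : Type*} [Field R] [CharZero R] (a b c : R) (k : ℕ) :
    gesselSeoSeries a b c ^ k = gesselSeoSeries a b (k * c) := by
  induction k with
  | zero => simp [gesselSeoSeries_zero]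
  | succ k ih => rw [pow_succ, ih, gesselSeoSeries_mul]; push_cast; ring_nf

/-- Since `b - s = ks`, all but the last factor agree for `n ≥ 1`; that last factor is `k(n + s)`,
whose `k` turns the prefactor `s` into `ks`. -/
theorem neg_gesselSeoP_succ_neg {R : Type*} [CommRing R] (k n : ℕ) (s : R) :
    -gesselSeoP (n + 1) (k : R) ((k + 1) * s) (-s)
      = (n + s) * gesselSeoP n (k : R) ((k + 1) * s) (k * s) := by
  cases n with
  | zero => simp [gesselSeoP_succ, gesselSeoP_zero]
  | succ n =>
    rw [gesselSeoP_succ, gesselSeoP_succ, Finset.prod_range_succ]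
    have h1 : ∀ i ∈ Finset.range n,
        (((i : R) + 1) * k + (((n + 1 : ℕ) : R) - (i : R)) * ((k + 1) * s) + -s)
        = ((i : R) + 1) * k + ((n : R) - (i : R)) * ((k + 1) * s) + k * s :=
      fun i _ => by push_cast; ring
    rw [Finset.prod_congr rfl h1]
    push_cast
    ring


-- Generating functions of weighted graded families.

/-- The generating function of a weighted graded family of finite sets. -/
noncomputable def weightSeries {R A : Type*} [CommRing R] (S : ℕ → Finset A) (w : A → R) : R⟦X⟧ :=
  PowerSeries.mk fun n => ∑ a ∈ S n, w a

/-- Unique decomposition: injectivity of `f` recovers the two pieces, and `sS`, `sT` recover their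
degrees. -/
theorem weightSeries_mul {R A B D : Type*} [CommRing R] {S : ℕ → Finset A} {T : ℕ → Finset B}
    {U : ℕ → Finset D} {w : A → R} {w' : B → R} {w'' : D → R} (f : A → B → D)
    (hf : Function.Injective2 f)
    (sS : A → ℕ) (sT : B → ℕ) (hS : ∀ n, ∀ a ∈ S n, sS a = n) (hT : ∀ n, ∀ b ∈ T n, sT b = n)
    (hU : ∀ n d, d ∈ U n ↔ ∃ i j, i + j = n ∧ ∃ a ∈ S i, ∃ b ∈ T j, f a b = d)
    (hw : ∀ a b, w'' (f a b) = w a * w' b) :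
    weightSeries U w'' = weightSeries S w * weightSeries T w' := by
  ext n
  simp only [weightSeries, coeff_mul, coeff_mk, Finset.sum_mul_sum, ← Finset.sum_product']
  rw [Finset.sum_sigma']
  refine (Finset.sum_bij (fun x _ => f x.2.1 x.2.2) ?_ ?_ ?_ ?_).symm
  · rintro ⟨⟨i, j⟩, a, b⟩ h
    simp only [Finset.mem_sigma, Finset.HasAntidiagonal.mem_antidiagonal, Finset.mem_product] at h
    exact (hU _ _).2 ⟨i, j, h.1, a, h.2.1, b, h.2.2, rfl⟩
  · rintro ⟨⟨i, j⟩, a, b⟩ h ⟨⟨i', j'⟩, a', b'⟩ h' e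
    simp only [Finset.mem_sigma, Finset.HasAntidiagonal.mem_antidiagonal, Finset.mem_product] at h h'
    obtain ⟨rfl, rfl⟩ := hf e
    obtain rfl := (hS _ _ h.2.1).symm.trans (hS _ _ h'.2.1)
    obtain rfl := (hT _ _ h.2.2).symm.trans (hT _ _ h'.2.2)
    rfl
  · intro d hd
    obtain ⟨i, j, hij, a, ha, b, hb, rfl⟩ := (hU _ _).1 hd
    exact ⟨⟨(i, j), a, b⟩, by simp [hij, ha, hb], rfl⟩
  · intros
    exact (hw _ _).symm

theorem weightSeries_filter_add {R A : Type*} [CommRing R] (S : ℕ → Finset A) (w : A → R)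
    (p : A → Prop) [DecidablePred p] :
    weightSeries (fun n => (S n).filter p) w + weightSeries (fun n => (S n).filter fun a => ¬ p a) w
      = weightSeries S w := by
  ext n
  simp [weightSeries, Finset.sum_filter_add_sum_filter_not]

-- Trees as a root with a list of children.

namespace EdgeColoredTree

variable {k : ℕ}

theorem verticesOfChildren_eq_flatMap (cs : List (Fin k × EdgeColoredTree k)) :
    verticesOfChildren cs = cs.flatMap fun p => p.2.vertices := by
  induction cs with
  | nil => simp [verticesOfChildren]
  | cons p cs ih => obtain ⟨c, t⟩ := p; simp [verticesOfChildren, ih]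

theorem isKColored_node (cs : List (Fin k × EdgeColoredTree k)) :
    (node cs).IsKColored ↔
      (cs.map Prod.fst).Pairwise (· ≤ ·) ∧ ∀ p ∈ cs, p.2.IsKColored := by
  simp only [IsKColored, vertices, verticesOfChildren_eq_flatMap, List.forall_mem_cons,
    List.mem_flatMap, children]
  refine and_congr_right fun _ => ⟨fun h p hp v hv => h v ⟨p, hp, hv⟩, ?_⟩
  rintro h v ⟨p, hp, hv⟩
  exact h p hp v hv

theorem hookProd_node {R : Type*} [Field R] (α : R) (cs : List (Fin k × EdgeColoredTree k)) :
    (node cs).hookProd α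
      = (1 + α / ((node cs).size : R)) * (cs.map fun p => p.2.hookProd α).prod := by
  rw [hookProd, vertices, List.map_cons, List.prod_cons, verticesOfChildren_eq_flatMap]
  congr 1
  induction cs with
  | nil => simp
  | cons p cs ih => simp [ih, hookProd]

theorem node_injective : Function.Injective (node : List (Fin k × EdgeColoredTree k) → _) :=
  fun _ _ h => by injection h

/-- The lists of children, with weakly increasing colors all at least `m`, of the `k`-colored
ordered trees on `n + 1` vertices. -/
noncomputable def childLists (k m n : ℕ) : Finset (List (Fin k × EdgeColoredTree k)) :=
  (((finite_kColoredOrderedTrees k (n + 1)).preimage node_injective.injOn).subset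
    (Set.inter_subset_left (t := {cs | ∀ p ∈ cs, m ≤ p.1.val}))).toFinset

theorem mem_childLists {m n : ℕ} {cs : List (Fin k × EdgeColoredTree k)} :
    cs ∈ childLists k m n ↔ ((cs.map Prod.fst).Pairwise (· ≤ ·) ∧ (∀ p ∈ cs, p.2.IsKColored)) ∧
      (cs.map fun p => p.2.size).sum = n ∧ ∀ p ∈ cs, m ≤ p.1.val := by
  simp [childLists, isKColored_node, size_node, add_comm 1, and_assoc]

theorem mem_kColoredOrderedTrees {n : ℕ} {t : EdgeColoredTree k} :
    t ∈ kColoredOrderedTrees k n ↔ t.IsKColored ∧ t.size = n := by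
  simp [kColoredOrderedTrees]

theorem mem_kColoredOrderedForests {n : ℕ} {F : EdgeColoredForest k} :
    F ∈ kColoredOrderedForests k n ↔ F.IsKColored ∧ F.size = n := by
  simp [kColoredOrderedForests]

-- Functional equations for trees and forests, and their solution.

section Series

variable {R : Type*} [Field R] (k) (α : R)

/-- The generating function of `k`-colored ordered trees weighted by hook products. -/
noncomputable def treeSeries : R⟦X⟧ :=
  weightSeries (kColoredOrderedTrees k) fun t => t.hookProd α

/-- The generating function of `k`-colored ordered forests weighted by hook products. -/
noncomputable def forestSeries : R⟦X⟧ :=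
  weightSeries (kColoredOrderedForests k) fun F => F.hookProd α

/-- The generating function of lists of children with colors at least `m`. -/
noncomputable def childSeries (m : ℕ) : R⟦X⟧ :=
  weightSeries (childLists k m) fun cs => (cs.map fun p => p.2.hookProd α).prod

/-- A nonempty forest splits uniquely into its first tree and the rest. -/
theorem forestSeries_eq : forestSeries k α = 1 + treeSeries k α * forestSeries k α := by
  classical
  rw [forestSeries, ← weightSeries_filter_add _ _ (fun F => F = [])]
  congr 1
  · ext n
    have h : (kColoredOrderedForests k n).filter (fun F => F = []) = if n = 0 then {[]} else ∅ := by
      ext F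
      have h0 : [] ∈ kColoredOrderedForests k n ↔ n = 0 := by
        simp [mem_kColoredOrderedForests, EdgeColoredForest.IsKColored, EdgeColoredForest.size,
          eq_comm]
      rw [Finset.mem_filter, and_congr_left (c := F = []) fun e => by rw [e, h0]]
      split_ifs with hn <;> simp [hn]
    simp only [weightSeries, coeff_mk, coeff_one, h]
    split_ifs <;> simp [EdgeColoredForest.hookProd]
  -- The opening rewrite also split the forest series on the right; this recombines it.
  · rw [weightSeries_filter_add]
    refine weightSeries_mul List.cons (fun _ _ _ _ h => by simpa using h) size
      EdgeColoredForest.size (fun n t ht => (mem_kColoredOrderedTrees.1 ht).2)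
      (fun n F hF => (mem_kColoredOrderedForests.1 hF).2) (fun n d => ?_) fun t F => ?_
    · simp only [Finset.mem_filter, mem_kColoredOrderedForests, mem_kColoredOrderedTrees]
      constructor
      · rintro ⟨⟨h1, h2⟩, h3⟩
        obtain ⟨t, F, rfl⟩ := List.exists_cons_of_ne_nil h3
        simp only [EdgeColoredForest.IsKColored, List.forall_mem_cons, EdgeColoredForest.size,
          List.map_cons, List.sum_cons] at h1 h2
        exact ⟨_, _, h2, t, ⟨h1.1, rfl⟩, F, ⟨h1.2, rfl⟩, rfl⟩
      · rintro ⟨i, j, hij, t, ⟨h1, h2⟩, F, ⟨h3, h4⟩, rfl⟩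
        refine ⟨⟨?_, ?_⟩, List.cons_ne_nil _ _⟩
        · simpa only [EdgeColoredForest.IsKColored, List.forall_mem_cons] using ⟨h1, h3⟩
        · rw [← hij, ← h2, ← h4]; simp [EdgeColoredForest.size]
    · simp [EdgeColoredForest.hookProd]

theorem childSeries_self : childSeries k α k = 1 := by
  have h : ∀ n, ∀ cs : List (Fin k × EdgeColoredTree k),
      cs ∈ childLists k k n ↔ n = 0 ∧ cs = [] := by
    intro n cs
    rw [mem_childLists]
    constructor
    · rintro ⟨-, h2, h3⟩
      cases cs with
      | nil => exact ⟨by simpa using h2.symm, rfl⟩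
      | cons p cs => exact absurd (h3 p List.mem_cons_self) (not_le.2 p.1.2)
    · rintro ⟨rfl, rfl⟩; simp
  ext n
  simp only [childSeries, weightSeries, coeff_mk, coeff_one]
  have : childLists k k n = if n = 0 then {[]} else ∅ := by
    ext cs
    rw [h]
    split_ifs with hn <;> simp [hn]
  rw [this]
  split_ifs <;> simp

/-- As colors weakly increase, either all exceed `m` or the first child has color exactly `m`;
deleting that child leaves a list with colors at least `m`. -/
theorem childSeries_eq {m : ℕ} (hm : m < k) :
    childSeries k α m = childSeries k α (m + 1) + treeSeries k α * childSeries k α m := by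
  classical
  rw [childSeries, ← weightSeries_filter_add _ _ (fun cs => ∀ p ∈ cs, m + 1 ≤ p.1.val)]
  congr 1
  · rw [childSeries]
    congr 1
    ext n cs
    simp only [Finset.mem_filter, mem_childLists]
    constructor
    · rintro ⟨⟨h1, h2, h3⟩, h4⟩
      exact ⟨h1, h2, h4⟩
    · rintro ⟨h1, h2, h3⟩
      exact ⟨⟨h1, h2, fun p hp => (Nat.le_succ m).trans (h3 p hp)⟩, h3⟩
  · rw [weightSeries_filter_add]
    refine weightSeries_mul (fun t cs => (⟨m, hm⟩, t) :: cs) (fun _ _ _ _ h => by simpa using h)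
      size (fun cs => (cs.map fun p => p.2.size).sum)
      (fun n t ht => (mem_kColoredOrderedTrees.1 ht).2)
      (fun n cs h => (mem_childLists.1 h).2.1) (fun n d => ?_) fun t cs => ?_
    · simp only [Finset.mem_filter, mem_childLists, mem_kColoredOrderedTrees]
      constructor
      · rintro ⟨⟨⟨h1, h2⟩, h3, h4⟩, h5⟩
        obtain _ | ⟨⟨c, t⟩, cs⟩ := d
        · simp at h5
        simp only [List.forall_mem_cons, List.map_cons, List.sum_cons, List.pairwise_cons] at *
        have hc : c = ⟨m, hm⟩ := by
          by_contra hc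
          have hlt : m + 1 ≤ c.val :=
            Nat.lt_of_le_of_ne h4.1 fun e => hc (Fin.ext e.symm)
          exact h5 ⟨hlt, fun p hp => hlt.trans (h1.1 _ (List.mem_map_of_mem hp))⟩
        subst hc
        exact ⟨_, _, h3, t, ⟨h2.1, rfl⟩, cs, ⟨⟨h1.2, h2.2⟩, rfl, h4.2⟩, rfl⟩
      · rintro ⟨i, j, hij, t, ⟨h1, h2⟩, cs, ⟨⟨h3, h4⟩, h5, h6⟩, rfl⟩
        simp only [List.forall_mem_cons, List.map_cons, List.sum_cons, List.pairwise_cons]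
        refine ⟨⟨⟨⟨?_, h3⟩, h1, h4⟩, by rw [h2, h5, hij], le_rfl, h6⟩, fun h => by
          have := h.1; simp at this⟩
        intro c hc
        obtain ⟨p, hp, rfl⟩ := List.mem_map.1 hc
        exact h6 p hp
    · simp

theorem forestSeries_mul_one_sub : forestSeries k α * (1 - treeSeries k α) = 1 := by
  linear_combination forestSeries_eq k α

/-- Each further color multiplies the series by `1/(1 - T) = F`. -/
theorem childSeries_sub_eq_pow {j : ℕ} (hj : j ≤ k) :
    childSeries k α (k - j) = forestSeries k α ^ j := by
  induction j with
  | zero => simp [childSeries_self]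
  | succ j ih =>
    have h := childSeries_eq k α (m := k - (j + 1)) (by omega)
    rw [show k - (j + 1) + 1 = k - j by omega, ih (by omega)] at h
    linear_combination forestSeries k α * h
      - childSeries k α (k - (j + 1)) * forestSeries_mul_one_sub k α

theorem coeff_succ_treeSeries (n : ℕ) :
    coeff (n + 1) (treeSeries k α)
      = (1 + α / ((n + 1 : ℕ) : R)) * coeff n (forestSeries k α ^ k) := by
  rw [← childSeries_sub_eq_pow k α le_rfl, Nat.sub_self]
  simp only [treeSeries, childSeries, weightSeries, coeff_mk, Finset.mul_sum]
  have hs : ∀ cs ∈ childLists k 0 n, (node cs).size = n + 1 := fun cs h => by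
    rw [size_node, (mem_childLists.1 h).2.1, add_comm]
  refine (Finset.sum_bij (fun cs _ => node cs) (fun cs h => ?_)
    (fun _ _ _ _ h => node_injective h) ?_ fun cs h => ?_).symm
  · exact mem_kColoredOrderedTrees.2 ⟨(isKColored_node cs).2 (mem_childLists.1 h).1, hs cs h⟩
  · rintro ⟨cs⟩ h
    obtain ⟨h1, h2⟩ := mem_kColoredOrderedTrees.1 h
    rw [size_node] at h2
    exact ⟨cs, mem_childLists.2 ⟨(isKColored_node cs).1 h1, by omega, by simp⟩, rfl⟩
  · rw [hookProd_node, hs cs h]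

theorem coeff_zero_treeSeries : coeff 0 (treeSeries k α) = 0 := by
  simp only [treeSeries, weightSeries, coeff_mk]
  refine Finset.sum_eq_zero fun t ht => ?_
  have := t.size_pos
  have := (mem_kColoredOrderedTrees.1 ht).2
  omega

theorem treeSeries_eq [CharZero R] :
    treeSeries k α = 1 - gesselSeoSeries (k : R) ((k + 1) * (1 + α)) (-(1 + α)) := by
  set G := gesselSeoSeries (k : R) ((k + 1) * (1 + α)) with hG
  set W := treeSeries k α
  have hF := forestSeries_mul_one_sub k α
  have hG1 : G (1 + α) * G (-(1 + α)) = 1 := by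
    rw [hG, gesselSeoSeries_mul, add_neg_cancel, gesselSeoSeries_zero]
  have h : ∀ n, X ^ (n + 1) ∣ W - (1 - G (-(1 + α))) := by
    intro n
    induction n with
    | zero =>
      rw [zero_add, pow_one, X_dvd_iff, ← coeff_zero_eq_constantCoeff_apply, map_sub,
        coeff_zero_treeSeries]
      simp [hG, gesselSeoSeries, gesselSeoP_zero]
    | succ n ih =>
      -- Agreement modulo `X^(n+1)` passes from `T` to `F`, because `F - G_s = (T - (1 - G_(-s))) F
      -- G_s`, and then to `k`-th powers.
      have hd : X ^ (n + 1) ∣ forestSeries k α ^ k - G (1 + α) ^ k := by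
        refine (ih.trans ⟨forestSeries k α * G (1 + α), ?_⟩).trans (sub_dvd_pow_sub_pow _ _ k)
        linear_combination G (1 + α) * hF - forestSeries k α * hG1
      have hc : coeff n (forestSeries k α ^ k) = coeff n (G (k * (1 + α))) := by
        rw [hG, ← gesselSeoSeries_pow]
        have := X_pow_dvd_iff.1 hd n n.lt_succ_self
        rwa [map_sub, sub_eq_zero] at this
      rw [X_pow_dvd_iff]
      intro m hm
      rcases Nat.lt_succ_iff_lt_or_eq.1 hm with hm | rfl
      · exact X_pow_dvd_iff.1 ih m hm
      rw [map_sub, coeff_succ_treeSeries, hc, map_sub, coeff_one, if_neg n.succ_ne_zero, zero_sub,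
        sub_eq_zero]
      simp only [hG, gesselSeoSeries, coeff_mk]
      -- The root's weight `1 + α/(n+1)` equals `(n+s)/(n+1)`, supplying the factor `n + s`.
      rw [← neg_div, neg_gesselSeoP_succ_neg, Nat.factorial_succ]
      have h1 : (n.factorial : R) ≠ 0 := mod_cast n.factorial_ne_zero
      have h2 : (n : R) + 1 ≠ 0 := mod_cast n.succ_ne_zero
      push_cast
      field_simp
      ring
  rw [← sub_eq_zero]
  ext n
  simpa using X_pow_dvd_iff.1 (h n) n n.lt_succ_self

theorem forestSeries_eq_gesselSeoSeries [CharZero R] :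
    forestSeries k α = gesselSeoSeries (k : R) ((k + 1) * (1 + α)) (1 + α) := by
  have hF := forestSeries_mul_one_sub k α
  rw [treeSeries_eq, sub_sub_cancel] at hF
  have hG1 := gesselSeoSeries_mul (k : R) ((k + 1) * (1 + α)) (1 + α) (-(1 + α))
  rw [add_neg_cancel, gesselSeoSeries_zero] at hG1
  linear_combination gesselSeoSeries (k : R) ((k + 1) * (1 + α)) (1 + α) * hF
    - forestSeries k α * hG1

end Series

end EdgeColoredTree

theorem mainTheorem9 {R : Type*} [Field R] [CharZero R] (k n : ℕ) (α : R) :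
    ((n.factorial : R) * ∑ F ∈ kColoredOrderedForests k n, F.hookProd α
        = gesselSeoP n (k : R) (((k : R) + 1) * (1 + α)) (1 + α)) ∧
    (1 ≤ n →
      (n.factorial : R) * ∑ T ∈ kColoredOrderedTrees k n, T.hookProd α
        = -gesselSeoP n (k : R) (((k : R) + 1) * (1 + α)) (-(1 + α))) := by
  have hn : (n.factorial : R) ≠ 0 := mod_cast n.factorial_ne_zero
  constructor
  · have h := congrArg (coeff n) (EdgeColoredTree.forestSeries_eq_gesselSeoSeries k α)
    simp only [EdgeColoredTree.forestSeries, weightSeries, gesselSeoSeries, coeff_mk] at h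
    rw [h, mul_div_cancel₀ _ hn]
  · intro h1
    have h := congrArg (coeff n) (EdgeColoredTree.treeSeries_eq k α)
    simp only [EdgeColoredTree.treeSeries, weightSeries, gesselSeoSeries, coeff_mk, map_sub,
      coeff_one, if_neg (Nat.one_le_iff_ne_zero.1 h1), zero_sub] at h
    rw [h, mul_neg, mul_div_cancel₀ _ hn]
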